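/- Let $G$ be a soluble group of finite (Prüfer) rank, i.e. there is an integer $r$ such that every finitely generated subgroup of $G$ can be generated by at most $r$ elements, and let $k$ be a field. Let $\mathrm{Soc}(G)$ be the subgroup of $G$ generated by all minimal normal subgroups of $G$ (with $\mathrm{Soc}(G)=1$ if there are none); since $G$ is soluble, $\mathrm{Soc}(G)$ is abelian. If $G$ has a faithful irreducible representation (of possibly infinite dimension) over $k$, then: 1. $\mathrm{Soc}(G)$, regarded as a $\mathbb{Z}G$-module on which $G$ acts by conjugation, is locally cyclic, i.e. every finitely generated $\mathbb{Z}G$-submodule of $\mathrm{Soc}(G)$ is generated by one element; 2. $\operatorname{char} k \notin \pi(\mathrm{Soc}(G))$, where $\pi(\mathrm{Soc}(G))$ is the set of primes dividing the order of some element of finite order of $\mathrm{Soc}(G)$. -/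

import Mathlib

open scoped IsMulCommutative

/-- `G` has finite (Prüfer) rank: for some `r`, every finitely generated subgroup of `G` can be
generated by at most `r` elements. -/
def HasFiniteRank (G : Type*) [Group G] : Prop :=
  ∃ r : ℕ, ∀ H : Subgroup G, H.FG →
    ∃ S : Finset G, S.card ≤ r ∧ Subgroup.closure (S : Set G) = H

/-- `N` is a minimal normal subgroup of `G`: a nontrivial normal subgroup that contains no
nontrivial normal subgroup of `G` other than itself. -/
structure IsMinimalNormal {G : Type*} [Group G] (N : Subgroup G) : Prop where
  normal : N.Normal
  ne_bot : N ≠ ⊥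
  eq_of_le : ∀ K : Subgroup G, K.Normal → K ≠ ⊥ → K ≤ N → K = N

/-- The socle of `G`: the subgroup generated by all minimal normal subgroups of `G`
(trivial if there are none). -/
def socle (G : Type*) [Group G] : Subgroup G :=
  sSup {N : Subgroup G | IsMinimalNormal N}

instance socle_normal (G : Type*) [Group G] : (socle G).Normal := by
  refine ⟨fun n hn g => ?_⟩
  have h : socle G ≤ (socle G).comap (MulAut.conj g).toMonoidHom := by
    refine sSup_le fun N hN x hx => ?_
    exact (le_sSup hN : N ≤ socle G) (hN.normal.conj_mem x hx g)
  exact h hn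

/-- The minimal normal subgroups of a soluble group are abelian. -/
theorem IsMinimalNormal.le_centralizer_self {G : Type*} [Group G] [Group.IsSolvable G]
    {N : Subgroup G} (hN : IsMinimalNormal N) : N ≤ Subgroup.centralizer (N : Set G) := by
  have := hN.normal
  have hlt := Group.IsSolvable.commutator_lt_of_ne_bot hN.ne_bot
  rw [← Subgroup.commutator_eq_bot_iff_le_centralizer]
  by_contra h
  exact hlt.ne (hN.eq_of_le _ inferInstance h hlt.le)

/-- Distinct minimal normal subgroups commute elementwise. -/
theorem IsMinimalNormal.le_centralizer {G : Type*} [Group G] [Group.IsSolvable G]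
    {M N : Subgroup G} (hM : IsMinimalNormal M) (hN : IsMinimalNormal N) :
    M ≤ Subgroup.centralizer (N : Set G) := by
  have := hM.normal
  have := hN.normal
  by_cases h : M ⊓ N = ⊥
  · rw [← Subgroup.commutator_eq_bot_iff_le_centralizer, eq_bot_iff, ← h]
    exact Subgroup.commutator_le_inf M N
  · have h1 := hM.eq_of_le _ inferInstance h inf_le_left
    have h2 := hN.eq_of_le _ inferInstance h inf_le_right
    have h3 : M = N := h1.symm.trans h2
    subst h3
    exact hM.le_centralizer_self

/-- The socle of a soluble group is abelian. -/
instance socle_isMulCommutative (G : Type*) [Group G] [Group.IsSolvable G] :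
    IsMulCommutative (socle G) := by
  have h : socle G ≤ Subgroup.centralizer (socle G : Set G) := by
    refine sSup_le fun M hM => ?_
    rw [Subgroup.le_centralizer_iff]
    refine sSup_le fun N hN => ?_
    exact hN.le_centralizer hM
  refine IsMulCommutative.of_comm fun a b => Subtype.ext ?_
  exact (Subgroup.mem_centralizer_iff.mp (h a.2) b b.2).symm

/-- The conjugation action of `G` on an abelian normal subgroup `A`, written additively. -/
noncomputable def conjRep {G : Type*} [Group G] (A : Subgroup G) [A.Normal]
    [IsMulCommutative A] : Representation ℤ G (Additive A) :=
  (Representation.ofMulDistribMulAction (ConjAct G) A).comp ConjAct.toConjAct.toMonoidHom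

/-- `g` sends `a` to its conjugate `g * a * g⁻¹`. -/
theorem conjRep_apply {G : Type*} [Group G] (A : Subgroup G) [A.Normal]
    [IsMulCommutative A] (g : G) (a : A) :
    ((conjRep A g (Additive.ofMul a)).toMul : G) = g * a * g⁻¹ :=
  rfl

/-- An abelian normal subgroup `A` of `G` as a module over the group ring `ℤG`, where `G` acts
by conjugation. -/
abbrev ConjModule {G : Type*} [Group G] (A : Subgroup G) [A.Normal] [IsMulCommutative A] :
    Type _ :=
  (conjRep A).asModule

/-- A module is locally cyclic if each of its finitely generated submodules is cyclic, that is,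
generated by one element. -/
def IsLocallyCyclicModule (R M : Type*) [Semiring R] [AddCommMonoid M] [Module R M] : Prop :=
  ∀ N : Submodule R M, N.FG → ∃ x : M, N = Submodule.span R {x}

/-- `π(H)`: the set of primes that divide the order of some element of finite order of `H`. -/
def primeSet {G : Type*} [Group G] (H : Subgroup G) : Set ℕ :=
  {p | p.Prime ∧ ∃ h ∈ H, IsOfFinOrder h ∧ p ∣ orderOf h}

/-! ### Groups of finite rank -/

/-! The group theory lies in `IsMinimalNormal.finite`: a minimal normal subgroup `N` of a soluble
group of finite rank is finite. If `N` has torsion, minimality bounds its exponent and finite rank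
makes it finite. If `N` is torsion-free, then `ℚ ⊗ N` is finite-dimensional, and for every prime `p`
minimality gives `x ∈ ℤG` with eigenvalue `1 / p` on it. But `G` is periodic over a finitely
generated subgroup `H` (`HasFiniteRank.exists_fg_forall_pow_mem`), and `H` acts by `p`-integral
matrices for some `p`; hence all traces of `ℤG` are `p`-integral, which forbids the eigenvalue `1 /
p`.

So every finite subset of the socle lies in a finite abelian normal subgroup `A`. Restricted to
`kA`, the representation has an associated prime `P`, the annihilator of a vector `w`. A normal
subgroup of `G` in the kernel of the character `A → kA/P` fixes `w`; its fixed vectors form a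
nonzero subrepresentation, hence everything, and faithfulness makes it trivial
(`Representation.exists_prime_of_isIrreducible`).

Both conclusions follow. A finitely generated submodule of the socle is finite and semisimple, and
this character together with Dedekind independence bounds its homomorphisms from each simple module,
which forces it to be cyclic. In characteristic `p`, the character kills the `p`-torsion of `A`,
which is therefore trivial. -/

theorem HasFiniteRank.of_surjective {G Q : Type*} [Group G] [Group Q] (hG : HasFiniteRank G)
    (f : G →* Q) (hf : Function.Surjective f) : HasFiniteRank Q := by
  classical
  obtain ⟨r, hr⟩ := hG
  refine ⟨r, ?_⟩
  rintro H ⟨T, rfl⟩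
  obtain ⟨S, hS, hST⟩ := hr (Subgroup.closure (T.image (Function.surjInv hf) : Finset G)) ⟨_, rfl⟩
  refine ⟨S.image f, Finset.card_image_le.trans hS, ?_⟩
  rw [Finset.coe_image, ← MonoidHom.map_closure, hST, MonoidHom.map_closure, Finset.coe_image,
    ← Set.image_comp, (Function.rightInverse_surjInv hf).comp_eq_id, Set.image_id]

theorem HasFiniteRank.of_injective {G K : Type*} [Group G] [Group K] (hG : HasFiniteRank G)
    (f : K →* G) (hf : Function.Injective f) : HasFiniteRank K := by
  classical
  obtain ⟨r, hr⟩ := hG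
  refine ⟨r, ?_⟩
  rintro H ⟨T, rfl⟩
  obtain ⟨S, hS, hST⟩ := hr (Subgroup.closure (T.image f : Finset G)) ⟨_, rfl⟩
  have hSr : (S : Set G) ⊆ Set.range f := by
    have h1 : Subgroup.closure (S : Set G) ≤ f.range := by
      rw [hST, Subgroup.closure_le]
      intro x hx
      obtain ⟨t, -, rfl⟩ := Finset.mem_image.mp (Finset.mem_coe.mp hx)
      exact ⟨t, rfl⟩
    exact Subgroup.subset_closure.trans h1
  refine ⟨S.preimage f hf.injOn, (Finset.card_le_card_of_injOn f ?_ hf.injOn).trans hS, ?_⟩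
  · intro x hx
    simpa using hx
  · apply Subgroup.map_injective hf
    rw [MonoidHom.map_closure, MonoidHom.map_closure, Finset.coe_preimage,
      Set.image_preimage_eq_of_subset hSr, hST, Finset.coe_image]

/-- An abelian group of exponent dividing `m` with `r` generators has at most `m ^ r` elements, so
`m ^ r + 1` elements cannot all lie in one. -/
theorem HasFiniteRank.finite_of_pow_eq_one {K : Type*} [CommGroup K] (hK : HasFiniteRank K)
    {m : ℕ} (hm : 0 < m) (h : ∀ x : K, x ^ m = 1) : Finite K := by
  classical
  obtain ⟨r, hr⟩ := hK
  by_contra hinf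
  rw [not_finite_iff_infinite] at hinf
  obtain ⟨F, hF⟩ := Infinite.exists_subset_card_eq K (m ^ r + 1)
  obtain ⟨S, hS, hSF⟩ := hr (Subgroup.closure (F : Set K)) ⟨F, rfl⟩
  have hcard : Nat.card (Subgroup.closure (S : Set K)) ∣
      m ^ Group.rank (Subgroup.closure (S : Set K)) :=
    card_dvd_exponent_pow_rank' _ fun x => Subtype.ext (by simpa using h x)
  have hle : Nat.card (Subgroup.closure (S : Set K)) ≤ m ^ r :=
    (Nat.le_of_dvd (by positivity) hcard).trans <|
      Nat.pow_le_pow_right hm ((Subgroup.rank_closure_finset_le_card S).trans hS)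
  have hfin : Finite (Subgroup.closure (S : Set K)) :=
    Nat.finite_of_card_ne_zero fun h0 => by
      rw [h0, zero_dvd_iff] at hcard
      exact (pow_pos hm _).ne' hcard
  have hsub : (F : Set K) ⊆ Subgroup.closure (S : Set K) := hSF ▸ Subgroup.subset_closure
  have h2 : F.card ≤ Nat.card (Subgroup.closure (S : Set K)) := by
    have := Nat.card_mono (Set.toFinite (Subgroup.closure (S : Set K) : Set K)) hsub
    rwa [Nat.card_coe_set_eq, Set.ncard_coe_finset] at this
  omega

theorem HasFiniteRank.finite_setOf_pow_eq_one {Q : Type*} [CommGroup Q] (hQ : HasFiniteRank Q)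
    {m : ℕ} (hm : 0 < m) : {q : Q | q ^ m = 1}.Finite := by
  have h : Finite (powMonoidHom m : Q →* Q).ker :=
    (hQ.of_injective (powMonoidHom m : Q →* Q).ker.subtype
      (Subgroup.subtype_injective _)).finite_of_pow_eq_one hm
      fun x => Subtype.ext (MonoidHom.mem_ker.mp x.2)
  exact Set.toFinite ((powMonoidHom m : Q →* Q).ker : Set Q)

/-- A maximal `ℤ`-independent subset works: any `r + 1` of its elements would lie in the span of `r`
elements, so it is finite, and maximality makes the quotient torsion. -/
theorem HasFiniteRank.exists_closure_torsion_quotient {A : Type*} [CommGroup A]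
    (hA : HasFiniteRank A) :
    ∃ S : Finset A, ∀ a : A, ∃ n : ℕ, 0 < n ∧ a ^ n ∈ Subgroup.closure (S : Set A) := by
  classical
  obtain ⟨r, hr⟩ := hA
  obtain ⟨s, hs, hmax⟩ := exists_maximal_linearIndepOn ℤ (Additive.toMul.symm : A → Additive A)
  have key : ∀ (S : Set A) (x : A), x ∈ Subgroup.closure S ↔
      Additive.ofMul x ∈ Submodule.span ℤ (Additive.toMul.symm '' S) := by
    intro S x
    rw [← Submodule.mem_toAddSubgroup, Submodule.span_int_eq_addSubgroupClosure,
      Equiv.image_eq_preimage_symm]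
    change Additive.ofMul x ∈ Subgroup.toAddSubgroup (Subgroup.closure S) ↔ _
    rw [Subgroup.toAddSubgroup_closure]
    rfl
  have hfin : s.Finite := by
    by_contra hinf
    obtain ⟨t, hts, htc⟩ := Set.Infinite.exists_subset_card_eq hinf (r + 1)
    obtain ⟨S, hS, hSt⟩ := hr (Subgroup.closure (t : Set A)) ⟨t, rfl⟩
    have hli := hs.mono hts
    have := linearIndependent_le_span' _ hli (Additive.toMul.symm '' (S : Set A)) (by
      rintro _ ⟨x, rfl⟩
      refine (key _ _).mp ?_
      rw [hSt]
      exact Subgroup.subset_closure x.2)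
    have h1 : Fintype.card (Additive.toMul.symm '' (S : Set A) : Set (Additive A)) ≤ S.card := by
      rw [← Nat.card_eq_fintype_card, Nat.card_coe_set_eq, ← Set.ncard_coe_finset S]
      exact Set.ncard_image_le S.finite_toSet
    have h2 : r + 1 ≤ Fintype.card (Additive.toMul.symm '' (S : Set A) : Set (Additive A)) := by
      rw [← htc]
      simpa using this
    omega
  refine ⟨hfin.toFinset, fun a => ?_⟩
  by_cases ha : a ∈ s
  · exact ⟨1, one_pos, by simpa using Subgroup.subset_closure ha⟩
  · obtain ⟨z, hz, hza⟩ := hmax a ha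
    refine ⟨z.natAbs, Int.natAbs_pos.mpr hz, ?_⟩
    rw [Set.Finite.coe_toFinset]
    have h1 : a ^ z ∈ Subgroup.closure s := (key _ _).mpr hza
    rcases Int.natAbs_eq z with h | h
    · rw [h, zpow_natCast] at h1
      exact h1
    · rw [h, zpow_neg, zpow_natCast] at h1
      exact inv_mem_iff.mp h1

/-- Let `A` be an abelian normal subgroup of finite rank, and `L` a subgroup that contains some power
of each element of `A`. Then each product `h * a` with `h ∈ L`, `a ∈ A` has a power in `L`. -/
theorem exists_pow_mul_mem {G : Type*} [Group G] (A L : Subgroup G) [A.Normal] [IsMulCommutative A]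
    (hA : HasFiniteRank A) (hL : ∀ a ∈ A, ∃ n : ℕ, 0 < n ∧ a ^ n ∈ L)
    {h a : G} (hh : h ∈ L) (ha : a ∈ A) : ∃ n : ℕ, 0 < n ∧ (h * a) ^ n ∈ L := by
  obtain ⟨m, hm, ham⟩ := hL a ha
  -- `(h * a) ^ i * (h ^ i)⁻¹` is the product of the conjugates of `a` by `h, ..., h ^ i`, which
  -- commute and have `m`-th powers in `L`. Its images in `A / (A ∩ L)` lie in the finite
  -- `m`-torsion, so two of them coincide.
  have hb : ∀ i : ℕ, (h * a) ^ i * (h ^ i)⁻¹ ∈ A ∧ ((h * a) ^ i * (h ^ i)⁻¹) ^ m ∈ L := by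
    intro i
    induction i with
    | zero => simp
    | succ i ih =>
      have e : (h * a) ^ (i + 1) * (h ^ (i + 1))⁻¹ =
          h * (a * ((h * a) ^ i * (h ^ i)⁻¹)) * h⁻¹ := by
        rw [pow_succ' (h * a), pow_succ h]
        group
      have hc : a * ((h * a) ^ i * (h ^ i)⁻¹) = ((h * a) ^ i * (h ^ i)⁻¹) * a :=
        congrArg Subtype.val (mul_comm (⟨a, ha⟩ : A) ⟨_, ih.1⟩)
      rw [e]
      refine ⟨Subgroup.Normal.conj_mem ‹_› _ (A.mul_mem ha ih.1) h, ?_⟩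
      rw [conj_pow, (show Commute a _ from hc).mul_pow]
      exact L.mul_mem (L.mul_mem hh (L.mul_mem ham ih.2)) (L.inv_mem hh)
  let B := L.subgroupOf A
  have hQ : HasFiniteRank (A ⧸ B) := hA.of_surjective (QuotientGroup.mk' B)
    (QuotientGroup.mk'_surjective B)
  let q : ℕ → A ⧸ B := fun i => QuotientGroup.mk' B ⟨_, (hb i).1⟩
  have hq : ∀ i, q i ∈ {q : A ⧸ B | q ^ m = 1} := by
    intro i
    change (QuotientGroup.mk' B ⟨_, (hb i).1⟩) ^ m = 1
    rw [← map_pow]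
    exact (QuotientGroup.eq_one_iff _).mpr (Subgroup.mem_subgroupOf.mpr (hb i).2)
  obtain ⟨i, -, j, -, hij, he⟩ := Set.infinite_univ.exists_ne_map_eq_of_mapsTo
    (fun i _ => hq i) (hQ.finite_setOf_pow_eq_one hm)
  wlog hlt : i < j generalizing i j
  · exact this j i hij.symm he.symm (lt_of_le_of_ne (not_lt.mp hlt) hij.symm)
  refine ⟨j - i, Nat.sub_pos_of_lt hlt, ?_⟩
  have h1 := Subgroup.mem_subgroupOf.mp (QuotientGroup.eq.mp he)
  have e : (h * a) ^ (j - i) = (h ^ i)⁻¹ *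
      (((h * a) ^ i * (h ^ i)⁻¹)⁻¹ * ((h * a) ^ j * (h ^ j)⁻¹)) * h ^ j := by
    rw [← pow_sub_mul_pow (h * a) hlt.le, (Commute.pow_pow_self (h * a) (j - i) i).eq]
    group
  rw [e]
  exact L.mul_mem (L.mul_mem (L.inv_mem (L.pow_mem hh i)) h1) (L.pow_mem hh j)

/-- A soluble group of finite rank has a finitely generated subgroup that contains some power of
each element. -/
theorem HasFiniteRank.exists_fg_forall_pow_mem {G : Type*} [Group G] [hs : Group.IsSolvable G]
    (hG : HasFiniteRank G) :
    ∃ H : Subgroup G, H.FG ∧ ∀ g : G, ∃ n : ℕ, 0 < n ∧ g ^ n ∈ H := by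
  classical
  obtain ⟨d, hd⟩ := hs.solvable
  clear hs
  induction d generalizing G with
  | zero =>
    refine ⟨⊥, ⟨∅, by simp⟩, fun g => ⟨1, one_pos, ?_⟩⟩
    rw [← hd]
    simp
  | succ d ih =>
    -- The last derived subgroup is abelian. Lifts of generators from `G ⧸ A`, together with
    -- finitely many elements of `A`, generate the required subgroup.
    let A := derivedSeries G d
    have hAn : A.Normal := derivedSeries_normal G d
    have hAc : IsMulCommutative A := by
      have h : A ≤ Subgroup.centralizer (A : Set G) := by
        rw [← Subgroup.commutator_eq_bot_iff_le_centralizer]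
        exact hd
      refine IsMulCommutative.of_comm fun a b => Subtype.ext ?_
      exact (Subgroup.mem_centralizer_iff.mp (h a.2) b b.2).symm
    have hA : HasFiniteRank A := hG.of_injective A.subtype A.subtype_injective
    obtain ⟨K, ⟨T, rfl⟩, hK⟩ := @ih (G ⧸ A) _ (hG.of_surjective (QuotientGroup.mk' A)
      (QuotientGroup.mk'_surjective A)) (by
        rw [← map_derivedSeries_eq (QuotientGroup.mk'_surjective A), ← le_bot_iff,
          Subgroup.map_le_iff_le_comap, MonoidHom.comap_bot, QuotientGroup.ker_mk'])
    obtain ⟨S, hS⟩ := hA.exists_closure_torsion_quotient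
    have hsurj := QuotientGroup.mk'_surjective A
    let X : Finset G := T.image (Function.surjInv hsurj)
    let Y : Finset G := S.image A.subtype
    let L := Subgroup.closure ((X ∪ Y : Finset G) : Set G)
    have hYL : ∀ a ∈ A, ∃ n : ℕ, 0 < n ∧ a ^ n ∈ L := by
      intro a ha
      obtain ⟨n, hn, h1⟩ := hS ⟨a, ha⟩
      refine ⟨n, hn, ?_⟩
      have h2 := Subgroup.mem_map_of_mem A.subtype h1
      rw [MonoidHom.map_closure] at h2
      refine Subgroup.closure_mono ?_ h2
      rw [Finset.coe_union, Finset.coe_image (s := S)]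
      exact Set.subset_union_right
    have hXL : Subgroup.closure (T : Set (G ⧸ A)) ≤ L.map (QuotientGroup.mk' A) := by
      rw [Subgroup.closure_le]
      intro t ht
      refine ⟨Function.surjInv hsurj t, Subgroup.subset_closure ?_, Function.surjInv_eq hsurj t⟩
      exact Finset.mem_coe.mpr (Finset.mem_union_left _ (Finset.mem_image_of_mem _ ht))
    refine ⟨L, ⟨_, rfl⟩, fun g => ?_⟩
    obtain ⟨n, hn, h1⟩ := hK (QuotientGroup.mk' A g)
    obtain ⟨h, hh, he⟩ := hXL h1
    rw [← map_pow] at he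
    have ha : h⁻¹ * g ^ n ∈ A := QuotientGroup.eq.mp he
    obtain ⟨m, hm, h2⟩ := exists_pow_mul_mem A L hA hYL hh ha
    refine ⟨n * m, Nat.mul_pos hn hm, ?_⟩
    rwa [mul_inv_cancel_left, ← pow_mul] at h2

/-! ### Integrality of traces -/

section Trace

open Polynomial

/-- If the traces of all integral polynomials in `f` are `p`-integral, then `1 / p` is not an
eigenvalue of `f`. -/
theorem Module.End.eq_zero_of_apply_eq_inv_smul {W : Type*} [AddCommGroup W] [Module ℚ W]
    [FiniteDimensional ℚ W] (p : ℕ) [Fact p.Prime] (f : Module.End ℚ W)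
    (hf : ∀ F : ℤ[X], ‖((LinearMap.trace ℚ W (aeval f F) : ℚ) : ℚ_[p])‖ ≤ 1)
    {w : W} (hw : f w = (p : ℚ)⁻¹ • w) : w = 0 := by
  by_contra hw0
  set c : ℚ := (p : ℚ)⁻¹ with hc
  have hvec : f.HasEigenvector c w := ⟨Module.End.mem_eigenspace_iff.mpr hw, hw0⟩
  have hm0 : minpoly ℚ f ≠ 0 := minpoly.ne_zero (Algebra.IsIntegral.isIntegral f)
  obtain ⟨q, hq, hdvd⟩ := exists_eq_pow_rootMultiplicity_mul_and_not_dvd (minpoly ℚ f) hm0 c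
  set d := rootMultiplicity c (minpoly ℚ f) with hd
  have hdpos : 0 < d := by
    rw [hd, rootMultiplicity_pos hm0]
    exact Module.End.isRoot_of_hasEigenvalue (Module.End.hasEigenvalue_of_hasEigenvector hvec)
  have hcop : IsCoprime ((X - C c) ^ d) q :=
    (((irreducible_X_sub_C c).coprime_iff_not_dvd).mpr hdvd).pow_left
  obtain ⟨a, b, hab⟩ := hcop
  have hzero : ∀ r : ℚ[X], minpoly ℚ f ∣ r → aeval f r = 0 := by
    rintro _ ⟨s, rfl⟩
    rw [map_mul, minpoly.aeval, zero_mul]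
  -- By Bézout, `e` is the projection onto the generalized eigenspace of `c`; it fixes `w`, so its
  -- trace is nonzero.
  set e := aeval f (b * q) with he
  have hidem : IsIdempotentElem e := by
    have h1 : aeval f ((b * q) * (b * q) - b * q) = 0 := by
      apply hzero
      refine ⟨-(a * b), ?_⟩
      rw [hq]
      linear_combination (b * q) * hab
    rw [map_sub, map_mul, sub_eq_zero] at h1
    exact h1
  have hew : e w = w := by
    have h1 := congrArg (fun r => aeval f r w) hab
    have h2 : aeval f (a * (X - C c) ^ d) w = 0 := by
      rw [Module.End.aeval_apply_of_hasEigenvector hvec]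
      simp [hdpos.ne']
    simpa [h2, map_add, -map_mul] using h1
  have hetr : LinearMap.trace ℚ W e ≠ 0 := by
    rw [Ne, LinearMap.IsIdempotentElem.trace_eq_zero_iff hidem]
    intro h0
    rw [h0] at hew
    exact hw0 hew.symm
  have htr : ∀ k : ℕ, LinearMap.trace ℚ W (aeval f (X ^ k * (b * q))) =
      c ^ k * LinearMap.trace ℚ W e := by
    -- On the image of `e`, `f ^ k - c ^ k` is nilpotent and so has trace zero.
    intro k
    obtain ⟨s, hs⟩ := sub_dvd_pow_sub_pow (X : ℚ[X]) (C c) k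
    have hnil : IsNilpotent (aeval f ((X ^ k - C c ^ k) * (b * q))) := by
      refine ⟨d, ?_⟩
      rw [← map_pow]
      apply hzero
      obtain ⟨j, hj⟩ := Nat.exists_eq_succ_of_ne_zero hdpos.ne'
      refine ⟨s ^ d * b ^ d * q ^ j, ?_⟩
      rw [hs, hq, mul_pow, mul_pow, mul_pow]
      nth_rewrite 4 [hj]
      rw [pow_succ]
      ring
    have h1 := (LinearMap.isNilpotent_trace_of_isNilpotent hnil).eq_zero
    rw [sub_mul, map_sub, map_sub, sub_eq_zero] at h1
    rw [h1, ← C_pow, ← smul_eq_C_mul, map_smul, map_smul, smul_eq_mul]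
  -- `D` clears the denominators of `b * q`. The traces of `f ^ k * (D * e)` are then `p`-integral
  -- for all `k`, yet equal `p ^ (-k)` times a fixed nonzero number.
  obtain ⟨D, hD, hDq⟩ := IsLocalization.integerNormalization_spec (nonZeroDivisors ℤ) (b * q)
  set F := IsLocalization.integerNormalization (nonZeroDivisors ℤ) (b * q)
  have hbound : ∀ k : ℕ, (p : ℝ) ^ k * ‖((D * LinearMap.trace ℚ W e : ℚ) : ℚ_[p])‖ ≤ 1 := by
    intro k
    have h1 := hf (X ^ k * F)
    have h2 : aeval f (X ^ k * F) = D • aeval f (X ^ k * (b * q)) := by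
      rw [← aeval_map_algebraMap ℚ, Polynomial.map_mul, hDq, Polynomial.map_pow, map_X,
        mul_smul_comm, map_zsmul]
    rw [h2, map_zsmul, htr, zsmul_eq_mul, mul_left_comm, Rat.cast_mul, norm_mul] at h1
    simpa [hc, norm_pow, Padic.norm_p] using h1
  have hpos : 0 < ‖((D * LinearMap.trace ℚ W e : ℚ) : ℚ_[p])‖ := by
    rw [norm_pos_iff, Ne, Rat.cast_eq_zero]
    exact mul_ne_zero (Int.cast_ne_zero.mpr (nonZeroDivisors.ne_zero hD)) hetr
  have hp1 : (1 : ℝ) < p := Nat.one_lt_cast.mpr (Fact.out : p.Prime).one_lt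
  obtain ⟨k, hk⟩ := pow_unbounded_of_one_lt (‖((D * LinearMap.trace ℚ W e : ℚ) : ℚ_[p])‖⁻¹) hp1
  have h3 := hbound k
  rw [← le_div_iff₀ hpos, one_div] at h3
  exact absurd hk (not_lt.mpr h3)

/-- An eigenvalue of a matrix with integral entries over a nonarchimedean field is integral. -/
theorem Matrix.norm_le_one_of_mulVec_eq_smul {n K : Type*} [Fintype n] [NormedField K]
    [IsUltrametricDist K] {A : Matrix n n K} (hA : ∀ i j, ‖A i j‖ ≤ 1) {x : K} {w : n → K}
    (hw0 : w ≠ 0) (hw : A.mulVec w = x • w) : ‖x‖ ≤ 1 := by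
  obtain ⟨i₀, hi₀⟩ := Function.ne_iff.mp hw0
  obtain ⟨i, -, hi⟩ := Finset.exists_max_image Finset.univ (fun i => ‖w i‖)
    ⟨i₀, Finset.mem_univ _⟩
  have hpos : 0 < ‖w i‖ := (norm_pos_iff.mpr hi₀).trans_le (hi i₀ (Finset.mem_univ _))
  have h1 : ‖x * w i‖ ≤ ‖w i‖ := by
    have : x * w i = ∑ j, A i j * w j := (congrFun hw i).symm
    rw [this]
    refine IsUltrametricDist.norm_sum_le_of_forall_le_of_nonneg hpos.le fun j _ => ?_
    rw [norm_mul]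
    exact (mul_le_of_le_one_left (norm_nonneg _) (hA i j)).trans (hi j (Finset.mem_univ _))
  rw [norm_mul] at h1
  exact (mul_le_iff_le_one_left hpos).mp h1

/-- A rational matrix with a `p`-integral power has `p`-integral trace. -/
theorem Matrix.norm_trace_le_one_of_pow {n : Type*} [Fintype n] [DecidableEq n] (p : ℕ)
    [Fact p.Prime] (A : Matrix n n ℚ) {m : ℕ} (hm : 0 < m)
    (hA : ∀ i j, ‖(((A ^ m) i j : ℚ) : ℚ_[p])‖ ≤ 1) : ‖((A.trace : ℚ) : ℚ_[p])‖ ≤ 1 := by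
  -- The trace is a sum of eigenvalues in the algebraic closure of `ℚ_[p]`, and their `m`-th powers
  -- are eigenvalues of the integral matrix `A ^ m`.
  let ι : ℚ →+* PadicAlgCl p := algebraMap ℚ (PadicAlgCl p)
  have hι : ∀ x : ℚ, ‖ι x‖ = ‖(x : ℚ_[p])‖ := by
    intro x
    rw [← PadicAlgCl.norm_extends]
    congr 1
  let B := A.map ι
  have htr : ι A.trace = B.trace := AddMonoidHom.map_trace ι.toAddMonoidHom A
  rw [← hι, htr, Matrix.trace_eq_sum_roots_charpoly]
  have hroot : ∀ x ∈ B.charpoly.roots, ‖x‖ ≤ 1 := by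
    intro x hx
    have hx' := (mem_roots'.mp hx).2
    rw [← Matrix.mem_spectrum_iff_isRoot_charpoly, ← Matrix.spectrum_toLin',
      ← Module.End.hasEigenvalue_iff_mem_spectrum] at hx'
    obtain ⟨w, hw⟩ := hx'.exists_hasEigenvector
    have hp := hw.pow_apply m
    rw [← Matrix.toLin'_pow, Matrix.toLin'_apply] at hp
    have h1 := Matrix.norm_le_one_of_mulVec_eq_smul (A := B ^ m) (fun i j => by
      have : (B ^ m) = (A ^ m).map ι := (map_pow ι.mapMatrix A m).symm
      rw [this, Matrix.map_apply, hι]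
      exact hA i j) hw.2 hp
    rw [norm_pow] at h1
    exact (pow_le_one_iff_of_nonneg (norm_nonneg _) hm.ne').mp h1
  revert hroot
  induction B.charpoly.roots using Multiset.induction with
  | empty => simp
  | cons a s ih =>
    intro h
    rw [Multiset.sum_cons]
    exact (IsUltrametricDist.norm_add_le_max _ _).trans
      (max_le (h a (Multiset.mem_cons_self a s)) (ih fun x hx => h x (Multiset.mem_cons_of_mem hx)))

/-- Let a group with a finitely generated subgroup containing a power of each element act on a
finite-dimensional rational vector space. For some prime `p` no element of the integral group ring
has the eigenvalue `1 / p`. -/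
theorem exists_prime_forall_lift_smul_apply_eq {G W : Type*} [Group G] [AddCommGroup W]
    [Module ℚ W] [FiniteDimensional ℚ W] {H : Subgroup G} (hH : H.FG)
    (hpow : ∀ g : G, ∃ n : ℕ, 0 < n ∧ g ^ n ∈ H) (φ : G →* Module.End ℚ W) :
    ∃ p : ℕ, p.Prime ∧ ∀ (x : MonoidAlgebra ℤ G) (w : W),
      (p : ℚ) • MonoidAlgebra.lift ℤ (Module.End ℚ W) G φ x w = w → w = 0 := by
  classical
  obtain ⟨T, rfl⟩ := hH
  let b := Module.finBasis ℚ W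
  let M : G →* Matrix (Fin (Module.finrank ℚ W)) (Fin (Module.finrank ℚ W)) ℚ :=
    (LinearMap.toMatrixAlgEquiv b).toAlgHom.toRingHom.toMonoidHom.comp φ
  -- A prime larger than `D` divides no denominator in the matrices of the generators and their
  -- inverses.
  let D : ℕ := ∏ t ∈ T, ∏ i, ∏ j, ((M t i j).den * (M t⁻¹ i j).den)
  have hD : 0 < D := Finset.prod_pos fun t _ => Finset.prod_pos fun i _ =>
    Finset.prod_pos fun j _ => Nat.mul_pos (M t i j).den_pos (M t⁻¹ i j).den_pos
  obtain ⟨p, hpD, hp⟩ := Nat.exists_infinite_primes (D + 1)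
  have : Fact p.Prime := ⟨hp⟩
  refine ⟨p, hp, ?_⟩
  have hdvd : ∀ t ∈ T, ∀ i j, (M t i j).den * (M t⁻¹ i j).den ∣ D := fun t ht i j =>
    ((Finset.dvd_prod_of_mem (fun j => (M t i j).den * (M t⁻¹ i j).den)
      (Finset.mem_univ j)).trans
      (Finset.dvd_prod_of_mem (fun i => ∏ j, (M t i j).den * (M t⁻¹ i j).den)
        (Finset.mem_univ i))).trans
      (Finset.dvd_prod_of_mem (fun t => ∏ i, ∏ j, (M t i j).den * (M t⁻¹ i j).den) ht)
  have hint : ∀ h ∈ Subgroup.closure (T : Set G), (∀ i j, ‖((M h i j : ℚ) : ℚ_[p])‖ ≤ 1) ∧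
      (∀ i j, ‖((M h⁻¹ i j : ℚ) : ℚ_[p])‖ ≤ 1) := by
    have hmul : ∀ x y, (∀ i j, ‖((M x i j : ℚ) : ℚ_[p])‖ ≤ 1) →
        (∀ i j, ‖((M y i j : ℚ) : ℚ_[p])‖ ≤ 1) → ∀ i j, ‖((M (x * y) i j : ℚ) : ℚ_[p])‖ ≤ 1 := by
      intro x y hx hy i j
      rw [map_mul, Matrix.mul_apply, Rat.cast_sum]
      refine IsUltrametricDist.norm_sum_le_of_forall_le_of_nonneg zero_le_one fun k _ => ?_
      rw [Rat.cast_mul, norm_mul]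
      exact mul_le_one₀ (hx i k) (norm_nonneg _) (hy k j)
    intro h hh
    induction hh using Subgroup.closure_induction with
    | mem t ht =>
      refine ⟨fun i j => Padic.norm_rat_le_one fun hpd => ?_,
        fun i j => Padic.norm_rat_le_one fun hpd => ?_⟩
      · exact absurd (Nat.le_of_dvd hD ((hpd.mul_right _).trans (hdvd t ht i j))) (by omega)
      · exact absurd (Nat.le_of_dvd hD ((hpd.mul_left _).trans (hdvd t ht i j))) (by omega)
    | one =>
      rw [inv_one, map_one, and_self]
      intro i j
      by_cases hij : i = j <;> simp [Matrix.one_apply, hij]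
    | mul x y _ _ hx hy =>
      rw [mul_inv_rev]
      exact ⟨hmul x y hx.1 hy.1, hmul _ _ hy.2 hx.2⟩
    | inv x _ hx =>
      rw [inv_inv]
      exact hx.symm
  have htrg : ∀ g, ‖((LinearMap.trace ℚ W (φ g) : ℚ) : ℚ_[p])‖ ≤ 1 := by
    intro g
    obtain ⟨m, hm, hg⟩ := hpow g
    rw [LinearMap.trace_eq_matrix_trace ℚ b]
    refine Matrix.norm_trace_le_one_of_pow p _ hm fun i j => ?_
    have : (LinearMap.toMatrix b b (φ g)) ^ m = M (g ^ m) := (map_pow M g m).symm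
    rw [this]
    exact (hint _ hg).1 i j
  set Φ := MonoidAlgebra.lift ℤ (Module.End ℚ W) G φ
  have htr : ∀ x, ‖((LinearMap.trace ℚ W (Φ x) : ℚ) : ℚ_[p])‖ ≤ 1 := by
    intro x
    induction x using MonoidAlgebra.induction_linear with
    | zero => simp
    | add x y hx hy =>
      rw [map_add, map_add, Rat.cast_add]
      exact (IsUltrametricDist.norm_add_le_max _ _).trans (max_le hx hy)
    | single g a =>
      rw [MonoidAlgebra.lift_single, map_zsmul, zsmul_eq_mul, Rat.cast_mul, norm_mul,
        Rat.cast_intCast]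
      exact mul_le_one₀ (Padic.norm_int_le_one a) (norm_nonneg _) (htrg g)
  intro x w hxw
  refine Module.End.eq_zero_of_apply_eq_inv_smul p (Φ x) (fun F => ?_)
    ((eq_inv_smul_iff₀ (Nat.cast_ne_zero.mpr hp.ne_zero)).mpr hxw)
  rw [aeval_algHom_apply]
  exact htr _

end Trace

/-! ### The conjugation module -/

namespace ConjModule

variable {G : Type*} [Group G] {A : Subgroup G} [A.Normal] [IsMulCommutative A]

/-- The element of `G` underlying an element of the conjugation module. -/
noncomputable def val (x : ConjModule A) : G := ((Additive.toMul ((conjRep A).asModuleEquiv x) : A) : G)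

/-- An element of `A`, regarded as an element of the conjugation module. -/
noncomputable def mk (a : G) (ha : a ∈ A) : ConjModule A :=
  (conjRep A).asModuleEquiv.symm (Additive.ofMul (⟨a, ha⟩ : A))

@[simp] theorem val_mk (a : G) (ha : a ∈ A) : val (mk a ha) = a := rfl

theorem val_mem (x : ConjModule A) : val x ∈ A := (Additive.toMul ((conjRep A).asModuleEquiv x)).2

theorem val_injective : Function.Injective (val : ConjModule A → G) := fun _ _ h =>
  (conjRep A).asModuleEquiv.injective (Additive.toMul.injective (Subtype.ext h))

@[simp] theorem val_zero : val (0 : ConjModule A) = 1 := rfl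

@[simp] theorem val_eq_one {x : ConjModule A} : val x = 1 ↔ x = 0 :=
  ⟨fun h => val_injective h, fun h => by rw [h, val_zero]⟩

@[simp] theorem val_add (x y : ConjModule A) : val (x + y) = val x * val y := rfl

@[simp] theorem val_neg (x : ConjModule A) : val (-x) = (val x)⁻¹ := rfl

@[simp] theorem val_nsmul (n : ℕ) (x : ConjModule A) : val (n • x) = val x ^ n := rfl

theorem val_single_smul (g : G) (n : ℤ) (x : ConjModule A) :
    val (MonoidAlgebra.single g n • x) = (g * val x * g⁻¹) ^ n := by
  rw [Representation.single_smul]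
  rfl

variable (A) in
/-- The submodule of the conjugation module given by a normal subgroup. -/
noncomputable def ofNormal (K : Subgroup G) [K.Normal] : Submodule (MonoidAlgebra ℤ G) (ConjModule A) where
  carrier := {x | val x ∈ K}
  add_mem' hx hy := K.mul_mem hx hy
  zero_mem' := K.one_mem
  smul_mem' c x hx := by
    change val (c • x) ∈ K
    induction c using MonoidAlgebra.induction_linear with
    | zero => rw [zero_smul]; exact K.one_mem
    | add c d hc hd => rw [add_smul, val_add]; exact K.mul_mem hc hd
    | single g n =>
      rw [val_single_smul]
      exact K.zpow_mem (Subgroup.Normal.conj_mem ‹_› _ hx g) n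

/-- The subgroup of `G` underlying a submodule of the conjugation module. -/
noncomputable def toSubgroup (P : Submodule (MonoidAlgebra ℤ G) (ConjModule A)) : Subgroup G where
  carrier := val '' (P : Set (ConjModule A))
  mul_mem' := by
    rintro _ _ ⟨x, hx, rfl⟩ ⟨y, hy, rfl⟩
    exact ⟨x + y, P.add_mem hx hy, val_add x y⟩
  one_mem' := ⟨0, P.zero_mem, val_zero⟩
  inv_mem' := by
    rintro _ ⟨x, hx, rfl⟩
    exact ⟨-x, P.neg_mem hx, val_neg x⟩

theorem mem_toSubgroup {P : Submodule (MonoidAlgebra ℤ G) (ConjModule A)} {g : G} :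
    g ∈ toSubgroup P ↔ ∃ x ∈ P, val x = g := Iff.rfl

theorem val_mem_toSubgroup {P : Submodule (MonoidAlgebra ℤ G) (ConjModule A)} {x : ConjModule A} :
    val x ∈ toSubgroup P ↔ x ∈ P :=
  val_injective.mem_set_image

instance toSubgroup_normal (P : Submodule (MonoidAlgebra ℤ G) (ConjModule A)) :
    (toSubgroup P).Normal := by
  refine ⟨?_⟩
  rintro _ ⟨x, hx, rfl⟩ g
  exact ⟨MonoidAlgebra.single g 1 • x, P.smul_mem _ hx, by rw [val_single_smul, zpow_one]⟩

theorem toSubgroup_le (P : Submodule (MonoidAlgebra ℤ G) (ConjModule A)) : toSubgroup P ≤ A := by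
  rintro _ ⟨x, -, rfl⟩
  exact val_mem x

theorem eq_bot_of_toSubgroup_eq_bot {P : Submodule (MonoidAlgebra ℤ G) (ConjModule A)}
    (h : toSubgroup P = ⊥) : P = ⊥ := by
  refine (Submodule.eq_bot_iff P).mpr fun x hx => ?_
  have := val_mem_toSubgroup.mpr hx
  rwa [h, Subgroup.mem_bot, val_eq_one] at this

end ConjModule

/-- The `m`-torsion of an abelian normal subgroup. -/
def torsionSubgroup {G : Type*} [Group G] (A : Subgroup G) [IsMulCommutative A] (m : ℕ) :
    Subgroup G :=
  (powMonoidHom m : A →* A).ker.map A.subtype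

theorem mem_torsionSubgroup {G : Type*} [Group G] {A : Subgroup G} [IsMulCommutative A] {m : ℕ}
    {x : G} : x ∈ torsionSubgroup A m ↔ x ∈ A ∧ x ^ m = 1 := by
  constructor
  · rintro ⟨y, hy, rfl⟩
    exact ⟨y.2, congrArg Subtype.val (MonoidHom.mem_ker.mp hy)⟩
  · rintro ⟨hx, h⟩
    exact ⟨⟨x, hx⟩, MonoidHom.mem_ker.mpr (Subtype.ext h), rfl⟩

instance torsionSubgroup_normal {G : Type*} [Group G] (A : Subgroup G) [A.Normal]
    [IsMulCommutative A] (m : ℕ) : (torsionSubgroup A m).Normal := by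
  refine ⟨fun x hx g => ?_⟩
  rw [mem_torsionSubgroup] at hx ⊢
  refine ⟨Subgroup.Normal.conj_mem ‹_› _ hx.1 g, ?_⟩
  rw [conj_pow, hx.2, mul_one, mul_inv_cancel]

/-! ### Minimal normal subgroups of soluble groups of finite rank are finite -/

open TensorProduct in
-- Tensoring with `ℚ` kills the torsion quotient of `HasFiniteRank.exists_closure_torsion_quotient`.
theorem HasFiniteRank.finiteDimensional_tensorProduct {A : Type*} [CommGroup A]
    (hA : HasFiniteRank A) : FiniteDimensional ℚ (ℚ ⊗[ℤ] Additive A) := by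
  classical
  obtain ⟨S, hS⟩ := hA.exists_closure_torsion_quotient
  refine ⟨⟨S.image fun s => (1 : ℚ) ⊗ₜ[ℤ] Additive.ofMul s, ?_⟩⟩
  set P := Submodule.span ℚ
    (S.image fun s => (1 : ℚ) ⊗ₜ[ℤ] Additive.ofMul s : Set (ℚ ⊗[ℤ] Additive A))
  have hcl : ∀ a ∈ Subgroup.closure (S : Set A), (1 : ℚ) ⊗ₜ[ℤ] Additive.ofMul a ∈ P := by
    intro a ha
    induction ha using Subgroup.closure_induction with
    | mem x hx => exact Submodule.subset_span (Finset.mem_image_of_mem _ hx)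
    | one => rw [ofMul_one, tmul_zero]; exact P.zero_mem
    | mul x y _ _ hx hy => rw [ofMul_mul, tmul_add]; exact P.add_mem hx hy
    | inv x _ hx => rw [ofMul_inv, tmul_neg]; exact P.neg_mem hx
  refine (Submodule.eq_top_iff'.mpr fun x => ?_)
  induction x using TensorProduct.induction_on with
  | zero => exact P.zero_mem
  | add x y hx hy => exact P.add_mem hx hy
  | tmul q a =>
    obtain ⟨n, hn, ha⟩ := hS a.toMul
    have h1 : q ⊗ₜ[ℤ] a = (q / n) • ((1 : ℚ) ⊗ₜ[ℤ] Additive.ofMul (a.toMul ^ n)) := by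
      rw [ofMul_pow, ofMul_toMul, tmul_smul, ← Nat.cast_smul_eq_nsmul ℚ, smul_smul,
        div_mul_cancel₀ _ (Nat.cast_ne_zero.mpr hn.ne'), smul_tmul', smul_eq_mul, mul_one]
    rw [h1]
    exact P.smul_mem _ (hcl _ ha)

open TensorProduct in
theorem IsMinimalNormal.finite {G : Type*} [Group G] [Group.IsSolvable G] (hG : HasFiniteRank G)
    {N : Subgroup G} (hN : IsMinimalNormal N) : Finite N := by
  have := hN.normal
  have : IsMulCommutative N := IsMulCommutative.of_comm fun a b => Subtype.ext
    (Subgroup.mem_centralizer_iff.mp (hN.le_centralizer_self a.2) b b.2).symm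
  have hNr : HasFiniteRank N := hG.of_injective N.subtype N.subtype_injective
  by_cases htor : ∃ m : ℕ, 0 < m ∧ torsionSubgroup N m ≠ ⊥
  · obtain ⟨m, hm, hm0⟩ := htor
    have he := hN.eq_of_le _ inferInstance hm0 fun x hx => (mem_torsionSubgroup.mp hx).1
    refine hNr.finite_of_pow_eq_one hm fun x => Subtype.ext ?_
    exact (mem_torsionSubgroup.mp (he.ge x.2)).2
  exfalso
  push Not at htor
  obtain ⟨H, hH, hpow⟩ := hG.exists_fg_forall_pow_mem
  have := hNr.finiteDimensional_tensorProduct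
  let β := Module.End.baseChangeHom ℤ ℚ (Additive N)
  obtain ⟨p, hp, hp'⟩ := exists_prime_forall_lift_smul_apply_eq hH hpow
    (β.toRingHom.toMonoidHom.comp (conjRep N))
  obtain ⟨v, hv, hv1⟩ := N.bot_or_exists_ne_one.resolve_left hN.ne_bot
  let y : ConjModule N := ConjModule.mk v hv
  have htf : ∀ (n : ℕ) (z : ConjModule N), 0 < n → n • z = 0 → z = 0 := by
    intro n z hn hz
    rw [← ConjModule.val_eq_one, ← Subgroup.mem_bot, ← htor n hn, mem_torsionSubgroup]
    exact ⟨ConjModule.val_mem z, by rw [← ConjModule.val_nsmul, hz, ConjModule.val_zero]⟩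
  have hy : y ≠ 0 := fun h => hv1 (ConjModule.val_eq_one.mpr h)
  -- Minimality makes `p • y` generate `N`, so `x • (p • y) = y` for some `x ∈ ℤG`: the eigenvalue
  -- `1 / p`, unless `1 ⊗ y = 0`, which would make `y` torsion.
  have hspan : ConjModule.toSubgroup (Submodule.span (MonoidAlgebra ℤ G) {p • y}) = N := by
    refine hN.eq_of_le _ inferInstance (fun h => hy (htf p y hp.pos ?_))
      (ConjModule.toSubgroup_le _)
    have := ConjModule.eq_bot_of_toSubgroup_eq_bot h
    rwa [Submodule.span_singleton_eq_bot] at this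
  obtain ⟨x, hx⟩ := Submodule.mem_span_singleton.mp
    (ConjModule.val_mem_toSubgroup.mp (hspan.ge (ConjModule.val_mem y)))
  have hcomp : ∀ x : MonoidAlgebra ℤ G, MonoidAlgebra.lift ℤ _ G
      (β.toRingHom.toMonoidHom.comp (conjRep N)) x = β ((conjRep N).asAlgebraHom x) := by
    intro x
    induction x using MonoidAlgebra.induction_linear with
    | zero => simp
    | add a b ha hb => rw [map_add, map_add, map_add, ha, hb]
    | single g n => simp
  let a : Additive N := (conjRep N).asModuleEquiv y
  have ha : (conjRep N).asAlgebraHom x (p • a) = a := by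
    have := congrArg (conjRep N).asModuleEquiv hx
    rwa [Representation.asModuleEquiv_map_smul, map_nsmul] at this
  have h0 : (1 : ℚ) ⊗ₜ[ℤ] a = 0 := by
    refine hp' x _ ?_
    rw [hcomp]
    change (p : ℚ) • ((1 : ℚ) ⊗ₜ[ℤ] ((conjRep N).asAlgebraHom x a)) = _
    rw [Nat.cast_smul_eq_nsmul ℚ, ← tmul_smul, ← map_nsmul, ha]
  have h1 := (IsLocalizedModule.eq_zero_iff (nonZeroDivisors ℤ)
    (TensorProduct.mk ℤ ℚ (Additive N) 1)).mp h0
  obtain ⟨c, hc⟩ := h1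
  refine hy (htf c.1.natAbs y (Int.natAbs_pos.mpr (nonZeroDivisors.ne_zero c.2)) ?_)
  have hc' : c.1 • y = 0 := hc
  rcases Int.natAbs_eq c.1 with h | h
  · rw [← natCast_zsmul, ← h, hc']
  · rw [← natCast_zsmul, ← neg_eq_zero, ← neg_smul, ← h, hc']

/-! ### Cyclic finite semisimple modules -/

section Semisimple

universe w

variable {R : Type*} [Ring R]

/-- Schur's lemma: without an isomorphism, both sides contain only zero. -/
theorem IsSimpleModule.card_linearMap_comm (S T : Type*) [AddCommGroup S] [Module R S]
    [IsSimpleModule R S] [AddCommGroup T] [Module R T] [IsSimpleModule R T] :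
    Nat.card (T →ₗ[R] S) = Nat.card (S →ₗ[R] T) := by
  by_cases he : Nonempty (T ≃ₗ[R] S)
  · obtain ⟨e⟩ := he
    exact Nat.card_congr (LinearEquiv.arrowCongrAddEquiv e e.symm).toEquiv
  · have h1 : Subsingleton (T →ₗ[R] S) := subsingleton_of_forall_eq 0 fun f =>
      (LinearMap.bijective_or_eq_zero f).resolve_left fun h =>
        he ⟨LinearEquiv.ofBijective f h⟩
    have h2 : Subsingleton (S →ₗ[R] T) := subsingleton_of_forall_eq 0 fun f =>
      (LinearMap.bijective_or_eq_zero f).resolve_left fun h =>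
        he ⟨(LinearEquiv.ofBijective f h).symm⟩
    rw [Nat.card_of_subsingleton 0, Nat.card_of_subsingleton 0]

theorem Submodule.card_linearMap_from_of_isCompl {B : Type*} [AddCommGroup B] [Module R B]
    {T C : Submodule R B} (h : IsCompl T C) (S : Type*) [AddCommGroup S] [Module R S] :
    Nat.card (B →ₗ[R] S) = Nat.card (T →ₗ[R] S) * Nat.card (C →ₗ[R] S) := by
  rw [← Nat.card_prod]
  exact Nat.card_congr ((LinearEquiv.arrowCongrAddEquiv (Submodule.prodEquivOfIsCompl T C h).symm
    (LinearEquiv.refl R S)).toEquiv.trans (LinearMap.coprodEquiv ℕ).symm.toEquiv)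

theorem Submodule.card_linearMap_to_of_isCompl {B : Type*} [AddCommGroup B] [Module R B]
    {T C : Submodule R B} (h : IsCompl T C) (S : Type*) [AddCommGroup S] [Module R S] :
    Nat.card (S →ₗ[R] B) = Nat.card (S →ₗ[R] T) * Nat.card (S →ₗ[R] C) := by
  rw [← Nat.card_prod]
  exact Nat.card_congr ((LinearEquiv.arrowCongrAddEquiv (LinearEquiv.refl R S)
    (Submodule.prodEquivOfIsCompl T C h).symm).toEquiv.trans (LinearMap.prodEquiv ℕ).symm.toEquiv)

theorem Submodule.card_lt_card_of_isCompl {B : Type*} [AddCommGroup B] [Module R B] [Finite B]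
    {T C : Submodule R B} (h : IsCompl T C) [Nontrivial T] : Nat.card C < Nat.card B := by
  rw [← Nat.card_congr (Submodule.prodEquivOfIsCompl T C h).toEquiv, Nat.card_prod]
  exact lt_mul_of_one_lt_left Nat.card_pos Finite.one_lt_card

/-- Between a finite semisimple module and a simple module there are as many homomorphisms in the
one direction as in the other. -/
theorem IsSemisimpleModule.card_linearMap_comm (S : Type*) [AddCommGroup S] [Module R S]
    [IsSimpleModule R S] (B : Type*) [AddCommGroup B] [Module R B] [Finite B]
    [IsSemisimpleModule R B] : Nat.card (B →ₗ[R] S) = Nat.card (S →ₗ[R] B) := by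
  induction hn : Nat.card B using Nat.strong_induction_on generalizing B with
  | _ n ih =>
    subst hn
    rcases subsingleton_or_nontrivial B with hB | hB
    · rw [Nat.card_of_subsingleton 0, Nat.card_of_subsingleton 0]
    · obtain ⟨T, hT⟩ := IsSemisimpleModule.exists_simple_submodule R B
      obtain ⟨C, hC⟩ := exists_isCompl T
      have := IsSimpleModule.nontrivial R T
      rw [Submodule.card_linearMap_from_of_isCompl hC, Submodule.card_linearMap_to_of_isCompl hC,
        IsSimpleModule.card_linearMap_comm,
        ih _ (Submodule.card_lt_card_of_isCompl hC) C rfl]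

/-- A finite semisimple module `A` is cyclic if each finite simple module `S` admits at most `|S|`
homomorphisms to `A`. -/
theorem IsSemisimpleModule.exists_span_singleton_eq_top {A : Type w} [AddCommGroup A] [Module R A]
    [Finite A] [IsSemisimpleModule R A]
    (h : ∀ (S : Type w) [AddCommGroup S] [Module R S] [Finite S] [IsSimpleModule R S],
      Nat.card (S →ₗ[R] A) ≤ Nat.card S) :
    ∃ a : A, Submodule.span R {a} = ⊤ := by
  induction hn : Nat.card A using Nat.strong_induction_on generalizing A with
  | _ n ih =>
    subst hn
    rcases subsingleton_or_nontrivial A with hA | hA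
    · exact ⟨0, Subsingleton.elim _ _⟩
    obtain ⟨T, hT⟩ := IsSemisimpleModule.exists_simple_submodule R A
    obtain ⟨B, hB⟩ := exists_isCompl T
    have := IsSimpleModule.nontrivial R T
    have hfin : ∀ (M N : Type w) [AddCommGroup M] [Module R M] [AddCommGroup N] [Module R N]
        [Finite M] [Finite N], Finite (M →ₗ[R] N) := fun M N _ _ _ _ _ _ =>
      Finite.of_injective _ DFunLike.coe_injective
    obtain ⟨b, hb⟩ := ih _ (Submodule.card_lt_card_of_isCompl hB) (A := B)
      (fun S _ _ _ _ => le_trans (by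
        have := hfin S A
        exact Nat.card_le_card_of_injective (fun g : S →ₗ[R] B => B.subtype.comp g)
          fun g g' hg => LinearMap.ext fun s => Subtype.ext (LinearMap.congr_fun hg s)) (h S)) rfl
    by_contra hcyc
    push Not at hcyc
    -- As `b + s` does not generate `A`, its span `C` is a complement of `T`: otherwise `T ≤ C`, so
    -- `b ∈ C` and `C = ⊤`. Hence `C` is the graph of a homomorphism `B → T` taking `b` to `s`.
    have hev : Function.Surjective fun φ : B →ₗ[R] T => φ b := by
      intro s
      let C := Submodule.span R {(b : A) + s}
      have hsC : (b : A) + s ∈ C := Submodule.mem_span_singleton_self _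
      have hBC : T ≤ C → C = ⊤ := by
        intro hTC
        have hbC : (b : A) ∈ C := (C.add_mem_iff_left (hTC s.2)).mp hsC
        have hBle : B ≤ C := by
          have h1 := congrArg (Submodule.map B.subtype) hb
          rw [Submodule.map_span, Set.image_singleton, Submodule.map_subtype_top] at h1
          rw [← h1]
          exact (Submodule.span_singleton_le_iff_mem _ _).mpr hbC
        exact top_le_iff.mp (hB.sup_eq_top.ge.trans (sup_le hTC hBle))
      have hTC : IsCompl T C := by
        refine ⟨?_, ?_⟩
        · exact (isSimpleModule_iff_isAtom.mp hT).not_le_iff_disjoint.mp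
            fun hle => hcyc _ (hBC hle)
        · rw [codisjoint_iff, ← top_le_iff, ← hB.sup_eq_top]
          refine sup_le le_sup_left ?_
          have h1 := congrArg (Submodule.map B.subtype) hb
          rw [Submodule.map_span, Set.image_singleton, Submodule.map_subtype_top] at h1
          rw [← h1, Submodule.span_singleton_le_iff_mem]
          refine ((T ⊔ C).add_mem_iff_left (Submodule.mem_sup_left s.2)).mp
            (Submodule.mem_sup_right hsC)
      refine ⟨-(T.projectionOnto C hTC).comp B.subtype, ?_⟩
      have h1 : T.projectionOnto C hTC ((b : A) + s) = 0 :=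
        (Submodule.projectionOnto_apply_eq_zero_iff hTC).mpr hsC
      rw [map_add, Submodule.projectionOnto_apply_left] at h1
      exact neg_eq_of_add_eq_zero_right h1
    have := hfin B T
    have := hfin T T
    -- Now `|T| ≤ |Hom(B, T)| = |Hom(T, B)|`, while `|Hom(T, A)| = |End T| * |Hom(T, B)| ≥ 2 * |T|`
    -- contradicts the bound.
    have h1 := Nat.card_le_card_of_surjective _ hev
    rw [IsSemisimpleModule.card_linearMap_comm T B] at h1
    have h2 := h T
    rw [Submodule.card_linearMap_to_of_isCompl hB] at h2
    have h3 : 1 < Nat.card (T →ₗ[R] T) := Finite.one_lt_card_iff_nontrivial.mpr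
      (inferInstanceAs (Nontrivial (Module.End R T)))
    have h4 : 0 < Nat.card T := Nat.card_pos
    nlinarith

/-- A finite semisimple module is cyclic if it has a character with values in a domain whose kernel
contains no nonzero submodule. -/
theorem IsSemisimpleModule.exists_span_singleton_eq_top_of_character {A : Type*} [AddCommGroup A]
    [Module R A] [Finite A] [IsSemisimpleModule R A] {L : Type*} [CommRing L] [IsDomain L]
    (f : Multiplicative A →* L)
    (hf : ∀ P : Submodule R A, (∀ x ∈ P, f (Multiplicative.ofAdd x) = 1) → P = ⊥) :
    ∃ a : A, Submodule.span R {a} = ⊤ := by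
  classical
  refine IsSemisimpleModule.exists_span_singleton_eq_top fun S _ _ _ _ => ?_
  let F : (S →ₗ[R] A) → (Multiplicative S →* L) := fun g => f.comp g.toAddMonoidHom.toMultiplicative
  -- If two pullbacks of `f` agree, the range of the difference of the homomorphisms lies in the
  -- kernel of `f`. Independence of characters then bounds their number by the rank `|S|` of the
  -- functions on `S`.
  have hF : Function.Injective F := by
    intro g g' h
    rw [← sub_eq_zero, ← LinearMap.range_eq_bot]
    refine hf _ ?_
    rintro _ ⟨s, rfl⟩
    have h1 : f (Multiplicative.ofAdd (g s)) = f (Multiplicative.ofAdd (g' s)) :=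
      DFunLike.congr_fun h (Multiplicative.ofAdd s)
    rw [LinearMap.sub_apply, sub_eq_add_neg, ofAdd_add, map_mul, h1, ← map_mul, ← ofAdd_add,
      add_neg_cancel, ofAdd_zero, map_one]
  have hli := (linearIndependent_monoidHom (Multiplicative S) L).comp F hF
  have := Finite.of_injective (fun g : S →ₗ[R] A => (g : S → A)) DFunLike.coe_injective
  have := Fintype.ofFinite (S →ₗ[R] A)
  have := Fintype.ofFinite (Multiplicative S)
  have h2 := hli.fintype_card_le_finrank
  rw [Module.finrank_fintype_fun_eq_card] at h2
  rwa [Nat.card_eq_fintype_card, ← Nat.card_congr (Multiplicative.toAdd (α := S)),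
    Nat.card_eq_fintype_card]

end Semisimple

/-! ### Faithful irreducible representations -/

/-- Let `A` be a finite abelian normal subgroup of a group with a faithful irreducible
representation `ρ` over `k`. The group algebra of `A` over `k` has a prime ideal such that the
character of `A` it gives has no nontrivial normal subgroup of `G` in its kernel. -/
theorem Representation.exists_prime_of_isIrreducible {G k V : Type*} [Group G] [Field k]
    [AddCommGroup V] [Module k V] (ρ : Representation k G V) (hfaithful : Function.Injective ρ)
    (hirr : ρ.IsIrreducible) (A : Subgroup G) [Finite A] [IsMulCommutative A] :
    ∃ P : Ideal (MonoidAlgebra k A), P.IsPrime ∧ ∀ K : Subgroup G, K.Normal →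
      (∀ x ∈ K, ∃ h : x ∈ A, MonoidAlgebra.of k A ⟨x, h⟩ - 1 ∈ P) → K = ⊥ := by
  let σ : Representation k A V := ρ.comp A.subtype
  have hV : Nontrivial V := by
    by_contra hV
    rw [not_nontrivial_iff_subsingleton] at hV
    obtain ⟨s, t, hst⟩ := hirr.toNontrivial.exists_pair_ne
    refine hst (Subrepresentation.toSubmodule_injective (Subsingleton.elim _ _))
  have : Nontrivial σ.asModule := hV
  have : IsNoetherianRing (MonoidAlgebra k A) := IsNoetherianRing.of_finite k _
  obtain ⟨P, hP⟩ := associatedPrimes.nonempty (MonoidAlgebra k A) σ.asModule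
  obtain ⟨hPp, w, hw⟩ := Submodule.isAssociatedPrime_iff.mp hP
  refine ⟨P, hPp, fun K hK hKP => ?_⟩
  let v : V := σ.asModuleEquiv w
  have hfix : ∀ x ∈ K, ρ x v = v := by
    intro x hx
    obtain ⟨hxA, hxP⟩ := hKP x hx
    rw [hw, Submodule.mem_colon_singleton, Submodule.mem_bot, sub_smul, one_smul, sub_eq_zero] at hxP
    have := congrArg σ.asModuleEquiv hxP
    rwa [Representation.asModuleEquiv_map_smul, Representation.asAlgebraHom_of] at this
  have hv : v ≠ 0 := by
    intro hv
    have hw0 : w = 0 := σ.asModuleEquiv.map_eq_zero_iff.mp hv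
    apply hPp.ne_top
    rw [hw, hw0, Ideal.eq_top_iff_one, Submodule.mem_colon_singleton, smul_zero]
    exact Submodule.zero_mem _
  -- The fixed vectors of `K` are stable under `G` because `K` is normal.
  let W : Subrepresentation ρ :=
    { toSubmodule := ⨅ x : K, LinearMap.eqLocus (ρ x) LinearMap.id
      apply_mem_toSubmodule := by
        intro g u hu
        rw [Submodule.mem_iInf] at hu ⊢
        intro x
        have h1 := hu ⟨g⁻¹ * x * g, by simpa using hK.conj_mem x x.2 g⁻¹⟩
        rw [LinearMap.mem_eqLocus, LinearMap.id_apply] at h1 ⊢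
        have h2 := congrArg (ρ g) h1
        rw [← Module.End.mul_apply, ← map_mul] at h2
        rw [← Module.End.mul_apply, ← map_mul]
        simpa [mul_assoc] using h2 }
  have hvW : v ∈ W.toSubmodule := by
    rw [Submodule.mem_iInf]
    exact fun x => hfix x x.2
  have hW : W = ⊤ := (hirr.eq_bot_or_eq_top W).resolve_left fun h => hv (by
    rw [h] at hvW
    exact (Submodule.mem_bot k).mp hvW)
  refine (Subgroup.eq_bot_iff_forall K).mpr fun x hx => hfaithful ?_
  rw [map_one]
  ext u
  have hu : u ∈ W.toSubmodule := by
    rw [hW]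
    exact Submodule.mem_top
  exact (Submodule.mem_iInf _).mp hu ⟨x, hx⟩

/-! ### The socle -/

section Socle

variable {G : Type*} [Group G]

theorem exists_finite_normal_of_mem_socle [Group.IsSolvable G] (hG : HasFiniteRank G) {x : G}
    (hx : x ∈ socle G) :
    ∃ A : Subgroup G, A.Normal ∧ Finite A ∧ A ≤ socle G ∧ x ∈ A := by
  rw [socle, sSup_eq_iSup'] at hx
  induction hx using Subgroup.iSup_induction' with
  | hp N x hx => exact ⟨N, N.2.normal, N.2.finite hG, le_sSup N.2, hx⟩
  | h1 => exact ⟨⊥, inferInstance, inferInstance, bot_le, Subgroup.mem_bot.mpr rfl⟩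
  | hmul x y _ _ hx hy =>
    obtain ⟨A, hAn, hAf, hA, hxA⟩ := hx
    obtain ⟨B, hBn, hBf, hB, hyB⟩ := hy
    refine ⟨A ⊔ B, inferInstance, ?_, sup_le hA hB, Subgroup.mul_mem_sup hxA hyB⟩
    have h : ((A ⊔ B : Subgroup G) : Set G).Finite := by
      rw [Subgroup.mul_normal]
      exact (Set.toFinite (A : Set G)).mul (Set.toFinite (B : Set G))
    exact h

theorem exists_finite_normal_of_finset [Group.IsSolvable G] (hG : HasFiniteRank G) (S : Finset G)
    (hS : (S : Set G) ⊆ socle G) :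
    ∃ A : Subgroup G, A.Normal ∧ Finite A ∧ A ≤ socle G ∧ (S : Set G) ⊆ A := by
  classical
  induction S using Finset.induction_on with
  | empty => exact ⟨⊥, inferInstance, inferInstance, bot_le, by simp⟩
  | insert x S _ ih =>
    rw [Finset.coe_insert, Set.insert_subset_iff] at hS
    obtain ⟨A, hAn, hAf, hA, hSA⟩ := ih hS.2
    obtain ⟨B, hBn, hBf, hB, hxB⟩ := exists_finite_normal_of_mem_socle hG hS.1
    refine ⟨B ⊔ A, inferInstance, ?_, sup_le hB hA, ?_⟩
    · have h : ((B ⊔ A : Subgroup G) : Set G).Finite := by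
        rw [Subgroup.mul_normal]
        exact (Set.toFinite (B : Set G)).mul (Set.toFinite (A : Set G))
      exact h
    · rw [Finset.coe_insert, Set.insert_subset_iff]
      exact ⟨Subgroup.mem_sup_left hxB, hSA.trans (SetLike.coe_subset_coe.mpr le_sup_right)⟩

/-- Submodules of the conjugation module are exactly the normal subgroups of `G` inside `A`. -/
theorem IsMinimalNormal.isSimpleModule_ofNormal {A N : Subgroup G} [A.Normal] [IsMulCommutative A]
    [N.Normal] (hN : IsMinimalNormal N) (hNA : N ≤ A) :
    IsSimpleModule (MonoidAlgebra ℤ G) (ConjModule.ofNormal A N) := by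
  rw [isSimpleModule_iff_isAtom]
  refine ⟨fun h => hN.ne_bot ?_, fun P hP => ?_⟩
  · refine (Subgroup.eq_bot_iff_forall N).mpr fun x hx => ?_
    have : ConjModule.mk x (hNA hx) ∈ ConjModule.ofNormal A N := hx
    rw [h, Submodule.mem_bot, ← ConjModule.val_eq_one] at this
    exact this
  · by_contra hP0
    have hle : ConjModule.toSubgroup P ≤ N := by
      rintro _ ⟨x, hx, rfl⟩
      exact hP.le hx
    have he := hN.eq_of_le _ inferInstance
      (fun h => hP0 (ConjModule.eq_bot_of_toSubgroup_eq_bot h)) hle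
    refine hP.not_ge fun x hx => ConjModule.val_mem_toSubgroup.mp ?_
    rw [he]
    exact hx

instance socle_isSemisimpleModule [Group.IsSolvable G] :
    IsSemisimpleModule (MonoidAlgebra ℤ G) (ConjModule (socle G)) := by
  refine IsSemisimpleModule.of_sSup_simples_eq_top (top_le_iff.mp ?_)
  set P := sSup {m : Submodule (MonoidAlgebra ℤ G) (ConjModule (socle G)) |
    IsSimpleModule (MonoidAlgebra ℤ G) m}
  have h : socle G ≤ ConjModule.toSubgroup P := by
    refine sSup_le fun N hN x hx => ?_
    have := hN.normal
    have hle : ConjModule.ofNormal (socle G) N ≤ P :=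
      le_sSup (hN.isSimpleModule_ofNormal (le_sSup hN))
    exact ⟨ConjModule.mk x (le_sSup (a := N) hN hx), hle hx, rfl⟩
  exact fun x _ => ConjModule.val_mem_toSubgroup.mp (h (ConjModule.val_mem x))

theorem Subgroup.isMulCommutative_of_le {A B : Subgroup G} [IsMulCommutative B] (h : A ≤ B) :
    IsMulCommutative A :=
  IsMulCommutative.of_comm fun a b => Subtype.ext
    (congrArg Subtype.val (mul_comm (⟨a, h a.2⟩ : B) ⟨b, h b.2⟩) :)

end Socle

/-! ### The two conclusions for the socle -/

section Main

variable {G k V : Type*} [Group G] [Group.IsSolvable G] [Field k] [AddCommGroup V] [Module k V]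

theorem isLocallyCyclicModule_socle (hG : HasFiniteRank G) (ρ : Representation k G V)
    (hfaithful : Function.Injective ρ) (hirr : ρ.IsIrreducible) :
    IsLocallyCyclicModule (MonoidAlgebra ℤ G) (ConjModule (socle G)) := by
  classical
  rintro _ ⟨S, rfl⟩
  obtain ⟨A, hAn, hAf, hA, hSA⟩ := exists_finite_normal_of_finset hG (S.image ConjModule.val) (by
    rw [Finset.coe_image]
    rintro _ ⟨x, -, rfl⟩
    exact ConjModule.val_mem x)
  set N := Submodule.span (MonoidAlgebra ℤ G) (S : Set (ConjModule (socle G)))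
  have hNA : ∀ x ∈ N, ConjModule.val x ∈ A := by
    have : N ≤ ConjModule.ofNormal (socle G) A := Submodule.span_le.mpr fun x hx =>
      hSA (Finset.mem_coe.mpr (Finset.mem_image_of_mem _ hx))
    exact this
  have := Subgroup.isMulCommutative_of_le hA
  obtain ⟨P, hP, hcore⟩ := ρ.exists_prime_of_isIrreducible hfaithful hirr A
  have : Finite N := Finite.of_injective (fun x : N => (⟨_, hNA x x.2⟩ : A)) fun x y h =>
    by
    refine Subtype.ext (ConjModule.val_injective ?_)
    exact (Subtype.ext_iff (a1 := (⟨_, hNA x x.2⟩ : A)) (a2 := ⟨_, hNA y y.2⟩)).mp h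
  let ν : Multiplicative N →* A :=
    { toFun := fun x => ⟨_, hNA x.toAdd x.toAdd.2⟩
      map_one' := rfl
      map_mul' := fun _ _ => rfl }
  let f : Multiplicative N →* MonoidAlgebra k A ⧸ P :=
    ((Ideal.Quotient.mk P).toMonoidHom.comp (MonoidAlgebra.of k A)).comp ν
  obtain ⟨a, ha⟩ := IsSemisimpleModule.exists_span_singleton_eq_top_of_character f (by
    intro Q hQ
    have hbot := hcore (ConjModule.toSubgroup (Q.map N.subtype)) inferInstance (by
      rintro _ ⟨_, ⟨x, hx, rfl⟩, rfl⟩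
      refine ⟨hNA x x.2, Ideal.Quotient.eq.mp ?_⟩
      rw [map_one]
      exact hQ x hx)
    refine Submodule.map_injective_of_injective N.subtype_injective ?_
    rw [Submodule.map_bot]
    exact ConjModule.eq_bot_of_toSubgroup_eq_bot hbot)
  refine ⟨a, ?_⟩
  have h1 := congrArg (Submodule.map N.subtype) ha
  rw [Submodule.map_span, Set.image_singleton, Submodule.map_subtype_top] at h1
  exact h1.symm

theorem ringChar_notMem_primeSet_socle (hG : HasFiniteRank G) (ρ : Representation k G V)
    (hfaithful : Function.Injective ρ) (hirr : ρ.IsIrreducible) :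
    ringChar k ∉ primeSet (socle G) := by
  -- Membership makes `ringChar k` prime, so characteristic zero drops out here.
  rintro ⟨hp, h, hh, hfin, hdvd⟩
  obtain ⟨A, hAn, hAf, hA, hhA⟩ := exists_finite_normal_of_mem_socle hG hh
  have := Subgroup.isMulCommutative_of_le hA
  obtain ⟨P, hP, hcore⟩ := ρ.exists_prime_of_isIrreducible hfaithful hirr A
  have : Fact (ringChar k).Prime := ⟨hp⟩
  have : CharP (MonoidAlgebra k A) (ringChar k) :=
    charP_of_injective_algebraMap (algebraMap k (MonoidAlgebra k A)).injective (ringChar k)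
  -- In characteristic `p`, `(x - 1) ^ p = x ^ p - 1 = 0` for `p`-torsion `x`, so the prime `P`
  -- contains `x - 1`.
  have hbot := hcore (torsionSubgroup A (ringChar k)) inferInstance fun x hx => by
    obtain ⟨hxA, hxp⟩ := mem_torsionSubgroup.mp hx
    refine ⟨hxA, hP.mem_of_pow_mem (ringChar k) ?_⟩
    have h1 : (⟨x, hxA⟩ : A) ^ ringChar k = 1 := Subtype.ext hxp
    rw [sub_pow_char, ← map_pow, h1, map_one, one_pow, sub_self]
    exact P.zero_mem
  have horder : orderOf (h ^ (orderOf h / ringChar k)) = ringChar k :=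
    orderOf_pow_orderOf_div hfin.orderOf_pos.ne' hdvd
  have hy : h ^ (orderOf h / ringChar k) ∈ torsionSubgroup A (ringChar k) := by
    refine mem_torsionSubgroup.mpr ⟨A.pow_mem hhA _, ?_⟩
    exact orderOf_dvd_iff_pow_eq_one.mp horder.dvd
  rw [hbot, Subgroup.mem_bot, ← orderOf_eq_one_iff, horder] at hy
  exact hp.one_lt.ne' hy

end Main

theorem theorem5p1 {G : Type*} [Group G] [Group.IsSolvable G] (hG : HasFiniteRank G)
    {k : Type*} [Field k] {V : Type*} [AddCommGroup V] [Module k V]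
    (ρ : Representation k G V) (hfaithful : Function.Injective ρ) (hirr : ρ.IsIrreducible) :
    IsLocallyCyclicModule (MonoidAlgebra ℤ G) (ConjModule (socle G)) ∧
      ringChar k ∉ primeSet (socle G) :=
  ⟨isLocallyCyclicModule_socle hG ρ hfaithful hirr,
    ringChar_notMem_primeSet_socle hG ρ hfaithful hirr⟩
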